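/- Let $\Omega=(0,\pi)\times\mathbb R^2$, write $x=(x_1,\underline x)$ with $\underline x=(x_2,x_3)$, and let $A=-\Delta$ be the Laplace operator in $L^2(\Omega)$ with Dirichlet boundary conditions, i.e. the operator that multiplies $\tilde u_k(\underline p)$ by $\underline p^2+k^2$ in the expansion $$u(x)=\tfrac12\pi^{-3}\sum_{k=1}^\infty\int_{\mathbb R^2}d\underline p\,\tilde u_k(\underline p)e^{i\underline p\,\underline x}\sin kx_1 .$$ For $k\in\mathbb N=\{1,2,\dots\}$ put $$s_k=\pi^{-2}\Big(-\ln\frac k2+C\Big)\quad(C\text{ the Euler constant}),\qquad e_k(x)=\tfrac12\pi^{-3}\int_{\mathbb R^2}d\underline p\,\frac{e^{i\underline p\,\underline x}}{\underline p^2+k^2}\,\sin kx_1$$ (here and below the integrals are Fourier integrals in the $L^2$ sense). Let $\alpha\in\mathbb R\setminus\{0\}$ with $1+\alpha k^2s_k\neq0$ for all $k$, and let $\tilde A=-\Delta\,\hat+\,\alpha(-\Delta_1)\delta(\underline x)$ be the operator in $L^2(\Omega)$ whose inverse is $$\tilde A^{-1}f=A^{-1}f-\sum_{k=1}^\infty\frac{\alpha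 k^2}{1+\alpha k^2s_k}\,(f,e_k)\,e_k .$$ Then the set of eigenvalues of $\tilde A$ is $\{E_k:k\in\mathbb N\}$, where $$E_k=k^2\big(1-e^{-2\beta_k}\big),\qquad \beta_k=-\pi^2(\alpha k^2)^{-1}\big(1+s_k\alpha k^2\big).$$ The vector $$f_k=\tfrac12\pi^{-3}\Big(\int_{\mathbb R^2}d\underline p\,\frac{e^{i\underline p\,\underline x}}{(\underline p^2+k^2)(\underline p^2+k^2-E_k)}\sin kx_1+\frac1{2\beta_kE_k}\ln\frac{k^2}{k^2-E_k}\int_{\mathbb R^2}d\underline p\,\frac{e^{i\underline p\,\underline x}}{\underline p^2+k^2}\sin kx_1\Big)$$ is an eigenvector for $E_k$, and $f_k=\tilde A^{-1}A(A-E_k)^{-1}e_k$, where $(A-E_k)^{-1}$ is the resolvent of the part of $A$ in $L^2(\mathbb R^2)\otimes\sin kx_1$. Every eigenvector of $\tilde A$ for an eigenvalue $E$ is a linear combination of the $f_k$ with $E_k=E$. Moreover $E_k\to\infty$ as $k\to\infty$, and $E_k$ belongs to the absolutely continuous spectrum of $\tilde A$ for all sufficiently large $k$. -/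

import Mathlib

open MeasureTheory Filter Topology FourierTransform

noncomputable section

namespace SingularLaplace

/-! ### The spaces -/

/-- The plane of the variables `(x₂, x₃)`, and also of the dual variables `(p₂, p₃)`. -/
abbrev Plane : Type := EuclideanSpace ℝ (Fin 2)

/-- Lebesgue measure on `Ω = (0, π) × ℝ²`. -/
def volΩ : Measure (ℝ × Plane) :=
  (volume.restrict (Set.Ioo 0 Real.pi)).prod volume

/-- `L²(ℝ²)`. -/
abbrev L2Plane : Type := Lp ℂ 2 (volume : Measure Plane)

/-- `L²(Ω)`. -/
abbrev L2Ω : Type := Lp ℂ 2 volΩ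

/-- The element of `L²(ℝ²)` given by a square integrable function `h`
(and `0` if `h` is not square integrable). -/
def toL2Plane (h : Plane → ℂ) : L2Plane := by
  classical
  exact if hh : MemLp h 2 volume then hh.toLp h else 0

/-- The functions to which `toL2Plane` is applied below are square integrable. -/
lemma memLp_symbol {a b : ℝ} (ha : 0 < a) (hb : 0 < b) :
    MemLp (fun p : Plane => (((‖p‖ ^ 2 + a : ℝ)⁻¹ : ℝ) : ℂ)) 2 volume ∧
    MemLp (fun p : Plane => ((((‖p‖ ^ 2 + a) * (‖p‖ ^ 2 + b) : ℝ)⁻¹ : ℝ) : ℂ)) 2 volume := by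
  have key : MemLp (fun p : Plane => (((‖p‖ ^ 2 + a : ℝ)⁻¹ : ℝ) : ℂ)) 2 volume := by
    have hm : Measurable (fun p : Plane => (((‖p‖ ^ 2 + a : ℝ)⁻¹ : ℝ) : ℂ)) :=
      Complex.measurable_ofReal.comp ((measurable_norm.pow_const 2).add_const a).inv
    rw [memLp_two_iff_integrable_sq_norm hm.aestronglyMeasurable]
    have hI : Integrable (fun p : Plane => ((1 : ℝ) + ‖p‖ ^ 2) ^ (-(4 : ℝ) / 2)) volume :=
      integrable_rpow_neg_one_add_norm_sq (by simp; norm_num)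
    have hc : 0 < min 1 a := lt_min one_pos ha
    refine (hI.const_mul ((min 1 a) ^ 2)⁻¹).mono' (hm.norm.pow_const 2).aestronglyMeasurable
      (Eventually.of_forall fun p => ?_)
    have hp : 0 ≤ ‖p‖ ^ 2 := by positivity
    have h1 : min 1 a * (1 + ‖p‖ ^ 2) ≤ ‖p‖ ^ 2 + a := by
      nlinarith [min_le_left 1 a, min_le_right 1 a]
    have h2 : 0 < min 1 a * (1 + ‖p‖ ^ 2) := by positivity
    have h3 : (‖p‖ ^ 2 + a)⁻¹ ≤ (min 1 a * (1 + ‖p‖ ^ 2))⁻¹ := inv_anti₀ h2 h1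
    have h4 : 0 ≤ (‖p‖ ^ 2 + a)⁻¹ := by positivity
    have h5 : ((1 : ℝ) + ‖p‖ ^ 2) ^ (-(4 : ℝ) / 2) = ((1 + ‖p‖ ^ 2) ^ 2)⁻¹ := by
      rw [show (-(4 : ℝ) / 2) = -((2 : ℕ) : ℝ) by norm_num, Real.rpow_neg (by positivity),
        Real.rpow_natCast]
    rw [h5, ← mul_inv, ← mul_pow, ← inv_pow, Complex.norm_real, Real.norm_of_nonneg h4,
      Real.norm_of_nonneg (by positivity)]
    exact pow_le_pow_left₀ h4 h3 2
  refine ⟨key, ?_⟩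
  have hm : Measurable
      (fun p : Plane => ((((‖p‖ ^ 2 + a) * (‖p‖ ^ 2 + b) : ℝ)⁻¹ : ℝ) : ℂ)) :=
    Complex.measurable_ofReal.comp
      (((measurable_norm.pow_const 2).add_const a).mul
        ((measurable_norm.pow_const 2).add_const b)).inv
  refine (key.const_mul ((b⁻¹ : ℝ) : ℂ)).of_le hm.aestronglyMeasurable
    (Eventually.of_forall fun p => ?_)
  have hp : 0 ≤ ‖p‖ ^ 2 := by positivity
  have h6 : (‖p‖ ^ 2 + b)⁻¹ ≤ b⁻¹ := inv_anti₀ hb (by linarith)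
  have h4 : 0 ≤ (‖p‖ ^ 2 + a)⁻¹ := by positivity
  rw [norm_mul, Complex.norm_real, Complex.norm_real, Complex.norm_real,
    Real.norm_of_nonneg (by positivity), Real.norm_of_nonneg (by positivity),
    Real.norm_of_nonneg h4, mul_inv, mul_comm]
  exact mul_le_mul_of_nonneg_right h6 h4

/-! ### Superpositions of plane waves times `sin (k x₁)`

With Mathlib's normalisation, `(𝓕⁻ h) y = ∫ exp (2 π i ⟨p, y⟩) h p dp`, extended to all `h ∈ L²(ℝ²)`
by continuity. Hence `∫ exp (i ⟨p, x⟩) h p dp = (𝓕⁻ h) (x / (2 π))`. -/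

/-- The function `x ↦ (1/2) π⁻³ (∫ exp (i ⟨p, (x₂, x₃)⟩) h p dp) sin (k x₁)`. -/
def modeFun (k : ℕ+) (h : L2Plane) (x : ℝ × Plane) : ℂ :=
  (2 * (Real.pi : ℂ) ^ 3)⁻¹ * ((𝓕⁻ h : L2Plane) : Plane → ℂ) ((2 * Real.pi)⁻¹ • x.2) *
    (Real.sin ((k : ℕ) * x.1) : ℂ)

lemma measurable_scaledSnd :
    Measurable (fun x : ℝ × Plane => (2 * Real.pi)⁻¹ • x.2) :=
  (measurable_const_smul ((2 * Real.pi)⁻¹ : ℝ)).comp measurable_snd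

lemma map_scaledSnd : ∃ c : ENNReal, c ≠ ⊤ ∧
    Measure.map (fun x : ℝ × Plane => (2 * Real.pi)⁻¹ • x.2) volΩ = c • volume := by
  have h0 : (2 * Real.pi)⁻¹ ≠ 0 := by positivity
  have h1 : Measure.map (fun x : ℝ × Plane => (2 * Real.pi)⁻¹ • x.2) volΩ =
      Measure.map (fun y : Plane => (2 * Real.pi)⁻¹ • y) (Measure.map Prod.snd volΩ) := by
    rw [Measure.map_map (measurable_const_smul ((2 * Real.pi)⁻¹ : ℝ))
      measurable_snd]
    rfl
  rw [h1, volΩ, Measure.map_snd_prod, Measure.map_smul, Measure.map_addHaar_smul _ h0, smul_smul]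
  exact ⟨_, ENNReal.mul_ne_top (by simp) ENNReal.ofReal_ne_top, rfl⟩

lemma quasiMeasurePreserving_scaledSnd :
    Measure.QuasiMeasurePreserving (fun x : ℝ × Plane => (2 * Real.pi)⁻¹ • x.2) volΩ volume := by
  obtain ⟨c, -, hc⟩ := map_scaledSnd
  exact ⟨measurable_scaledSnd, hc ▸ Measure.smul_absolutelyContinuous⟩

lemma memLp_modeFun (k : ℕ+) (h : L2Plane) : MemLp (modeFun k h) 2 volΩ := by
  obtain ⟨c, hc, hm⟩ := map_scaledSnd
  have h1 : MemLp ((𝓕⁻ h : L2Plane) : Plane → ℂ) 2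
      (Measure.map (fun x : ℝ × Plane => (2 * Real.pi)⁻¹ • x.2) volΩ) := by
    rw [hm]
    exact (Lp.memLp _).smul_measure hc
  have h2 : MemLp (fun x : ℝ × Plane =>
      ((𝓕⁻ h : L2Plane) : Plane → ℂ) ((2 * Real.pi)⁻¹ • x.2)) 2 volΩ :=
    h1.comp_of_map measurable_scaledSnd.aemeasurable
  have h3 := h2.const_mul (2 * (Real.pi : ℂ) ^ 3)⁻¹
  have hs : Measurable (fun x : ℝ × Plane => (Real.sin ((k : ℕ) * x.1) : ℂ)) :=
    Complex.measurable_ofReal.comp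
      (Real.measurable_sin.comp (measurable_fst.const_mul ((k : ℕ) : ℝ)))
  refine h3.of_le (h3.1.mul hs.aestronglyMeasurable) (Eventually.of_forall fun x => ?_)
  rw [modeFun, norm_mul _ (_ : ℂ), Complex.norm_real, Real.norm_eq_abs]
  exact mul_le_of_le_one_right (norm_nonneg _) (Real.abs_sin_le_one _)

lemma modeFun_add (k : ℕ+) (h₁ h₂ : L2Plane) :
    modeFun k (h₁ + h₂) =ᵐ[volΩ] modeFun k h₁ + modeFun k h₂ := by
  have := quasiMeasurePreserving_scaledSnd.ae
    (Lp.coeFn_add (𝓕⁻ h₁ : L2Plane) (𝓕⁻ h₂ : L2Plane))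
  filter_upwards [this] with x hx
  simp only [modeFun, Pi.add_apply, FourierTransform.fourierInv_add] at hx ⊢
  rw [hx]
  ring

lemma modeFun_smul (k : ℕ+) (c : ℂ) (h : L2Plane) :
    modeFun k (c • h) =ᵐ[volΩ] c • modeFun k h := by
  have := quasiMeasurePreserving_scaledSnd.ae (Lp.coeFn_smul c (𝓕⁻ h : L2Plane))
  filter_upwards [this] with x hx
  simp only [modeFun, Pi.smul_apply, FourierTransform.fourierInv_smul, smul_eq_mul] at hx ⊢
  rw [hx]
  ring

/-- `mode k h` is the element
`(1/2) π⁻³ (∫ exp (i ⟨p, (x₂, x₃)⟩) h p dp) sin (k x₁)` of `L²(Ω)`. -/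
def mode (k : ℕ+) : L2Plane →ₗ[ℂ] L2Ω where
  toFun h := (memLp_modeFun k h).toLp (modeFun k h)
  map_add' h₁ h₂ := by
    rw [← MemLp.toLp_add, MemLp.toLp_eq_toLp_iff]
    exact modeFun_add k h₁ h₂
  map_smul' c h := by
    rw [RingHom.id_apply, ← MemLp.toLp_const_smul, MemLp.toLp_eq_toLp_iff]
    exact modeFun_smul k c h

/-! ### The Dirichlet Laplacian -/

/-- The graph of the Dirichlet Laplacian `-Δ` on `Ω`: pairs `(u, v)` with
`u = ∑ₖ (1/2) π⁻³ (∫ exp (i ⟨p, (x₂, x₃)⟩) aₖ(p) dp) sin (k x₁)` and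
`v = ∑ₖ (1/2) π⁻³ (∫ exp (i ⟨p, (x₂, x₃)⟩) (|p|² + k²) aₖ(p) dp) sin (k x₁)`,
both series being convergent in `L²(Ω)`. -/
def dirichletGraph : Submodule ℂ (L2Ω × L2Ω) where
  carrier := {w | ∃ a b : ℕ+ → L2Plane,
    (∀ k, ∀ᵐ p : Plane, b k p = ((‖p‖ ^ 2 + (k : ℕ) ^ 2 : ℝ) : ℂ) * a k p) ∧
    HasSum (fun k => mode k (a k)) w.1 ∧ HasSum (fun k => mode k (b k)) w.2}
  zero_mem' := by
    refine ⟨fun _ => 0, fun _ => 0, fun k => ?_, ?_, ?_⟩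
    · filter_upwards [Lp.coeFn_zero ℂ 2 (volume : Measure Plane)] with p hp
      rw [hp]; simp
    · simp [hasSum_zero]
    · simp [hasSum_zero]
  add_mem' := by
    rintro w w' ⟨a, b, h, ha, hb⟩ ⟨a', b', h', ha', hb'⟩
    refine ⟨fun k => a k + a' k, fun k => b k + b' k, fun k => ?_, ?_, ?_⟩
    · filter_upwards [h k, h' k, Lp.coeFn_add (a k) (a' k), Lp.coeFn_add (b k) (b' k)]
        with p h1 h2 h3 h4
      rw [h3, h4, Pi.add_apply, Pi.add_apply, h1, h2, mul_add]
    · simpa only [map_add, Prod.fst_add] using ha.add ha'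
    · simpa only [map_add, Prod.snd_add] using hb.add hb'
  smul_mem' := by
    rintro c w ⟨a, b, h, ha, hb⟩
    refine ⟨fun k => c • a k, fun k => c • b k, fun k => ?_, ?_, ?_⟩
    · filter_upwards [h k, Lp.coeFn_smul c (a k), Lp.coeFn_smul c (b k)] with p h1 h3 h4
      rw [h3, h4, Pi.smul_apply, Pi.smul_apply, h1, smul_eq_mul, smul_eq_mul, mul_left_comm]
    · simpa only [map_smul, Prod.smul_fst] using ha.const_smul c
    · simpa only [map_smul, Prod.smul_snd] using hb.const_smul c

/-- The Dirichlet Laplacian `A = -Δ` in `L²(Ω)`. -/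
def dirichletLaplacian : L2Ω →ₗ.[ℂ] L2Ω := dirichletGraph.toLinearPMap

/-! ### The singular perturbation -/

/-- `sₖ = π⁻² (-ln (k/2) + C)`, where `C` is the Euler constant. -/
def s (k : ℕ+) : ℝ :=
  (Real.pi ^ 2)⁻¹ * (-Real.log ((k : ℕ) / 2) + Real.eulerMascheroniConstant)

/-- `eₖ(x) = (1/2) π⁻³ (∫ exp (i ⟨p, (x₂, x₃)⟩) / (|p|² + k²) dp) sin (k x₁)`. -/
def e (k : ℕ+) : L2Ω :=
  mode k (toL2Plane fun p => ((‖p‖ ^ 2 + (k : ℕ) ^ 2 : ℝ)⁻¹ : ℝ))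

/-- The coefficient `-α k² / (1 + α k² sₖ)`. -/
def coeff (α : ℝ) (k : ℕ+) : ℝ :=
  -(α * (k : ℕ) ^ 2) / (1 + α * (k : ℕ) ^ 2 * s k)

/-- The operator `f ↦ ∑ₖ -α k² (1 + α k² sₖ)⁻¹ (f, eₖ) eₖ`, on all `f` for which the series
converges in `L²(Ω)`. -/
def perturbation (α : ℝ) : L2Ω →ₗ.[ℂ] L2Ω where
  domain :=
    { carrier := {f | Summable fun k => ((coeff α k : ℂ) * inner ℂ (e k) f) • e k}
      zero_mem' := by simp [summable_zero]
      add_mem' := by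
        intro f g hf hg
        simpa only [Set.mem_ofPred_eq, inner_add_right, mul_add, add_smul] using
          Summable.add hf hg
      smul_mem' := by
        intro c f hf
        simpa only [Set.mem_ofPred_eq, inner_smul_right, mul_left_comm _ c, mul_smul c] using
          Summable.const_smul c hf }
  toFun :=
    { toFun := fun f => ∑' k, ((coeff α k : ℂ) * inner ℂ (e k) (f : L2Ω)) • e k
      map_add' := by
        intro f g
        simpa only [Submodule.coe_add, inner_add_right, mul_add, add_smul] using
          Summable.tsum_add f.2 g.2
      map_smul' := by
        intro c f
        simpa only [Submodule.coe_smul, inner_smul_right, mul_left_comm _ c, mul_smul c,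
          RingHom.id_apply] using Summable.tsum_const_smul c f.2 }

/-- The operator `-Δ +̂ α (-Δ₁) δ(x̲)`: the operator in `L²(Ω)` whose inverse is
`(-Δ)⁻¹ + ∑ₖ -α k² (1 + α k² sₖ)⁻¹ (·, eₖ) eₖ`. -/
def perturbedLaplacian (α : ℝ) : L2Ω →ₗ.[ℂ] L2Ω :=
  (dirichletLaplacian.inverse + perturbation α).inverse

/-! ### Eigenvalues and absolutely continuous spectrum -/

section Spectrum

variable {H : Type*} [NormedAddCommGroup H] [InnerProductSpace ℂ H]

/-- The set of (real) eigenvalues of `T`. -/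
def pointSpectrum (T : H →ₗ.[ℂ] H) : Set ℝ :=
  {E | ∃ f : T.domain, (f : H) ≠ 0 ∧ T f = (E : ℂ) • (f : H)}

/-- `μ` is the spectral measure of the self-adjoint operator `T` at the vector `f`: it is the finite
measure on `ℝ` with `(f, (T - z)⁻¹ f) = ∫ (t - z)⁻¹ dμ(t)` for all non-real `z`. -/
def IsSpectralMeasure (T : H →ₗ.[ℂ] H) (f : H) (μ : Measure ℝ) : Prop :=
  IsFiniteMeasure μ ∧ ∀ z : ℂ, z.im ≠ 0 →
    ∃ u : T.domain, T u - z • (u : H) = f ∧ inner ℂ f (u : H) = ∫ t : ℝ, ((t : ℂ) - z)⁻¹ ∂μ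

/-- The absolutely continuous subspace of `T`: the vectors with a spectral measure that is
absolutely continuous with respect to Lebesgue measure. -/
def acSubspace (T : H →ₗ.[ℂ] H) : Set H :=
  {f | ∃ μ : Measure ℝ, IsSpectralMeasure T f μ ∧ μ ≪ volume}

/-- The absolutely continuous spectrum of the self-adjoint operator `T`: the spectrum of the part of
`T` in its absolutely continuous subspace, i.e. the set of those real `E` for which `T - E` is not a
bijection from the vectors of `D(T)` in that subspace onto that subspace. (A bijective `T - E` has a
bounded inverse, by the closed graph theorem.) -/
def acSpectrum (T : H →ₗ.[ℂ] H) : Set ℝ :=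
  {E | ¬ ∀ h ∈ acSubspace T, ∃! f : T.domain,
    (f : H) ∈ acSubspace T ∧ T f - (E : ℂ) • (f : H) = h}

end Spectrum

/-! ### The explicit eigenvalues and eigenvectors -/

/-- `βₖ = -π² (α k²)⁻¹ (1 + sₖ α k²)`. -/
def β (α : ℝ) (k : ℕ+) : ℝ :=
  -Real.pi ^ 2 * (α * (k : ℕ) ^ 2)⁻¹ * (1 + s k * α * (k : ℕ) ^ 2)

/-- `Eₖ = k² (1 - exp (-2 βₖ))`. -/
def energy (α : ℝ) (k : ℕ+) : ℝ :=
  (k : ℕ) ^ 2 * (1 - Real.exp (-2 * β α k))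

lemma energy_lt (α : ℝ) (k : ℕ+) : 0 < (k : ℕ) ^ 2 - energy α k := by
  have hk : (0 : ℝ) < ((k : ℕ) : ℝ) := by exact_mod_cast k.pos
  have : (k : ℕ) ^ 2 - energy α k = (k : ℕ) ^ 2 * Real.exp (-2 * β α k) := by
    unfold energy; ring
  rw [this]
  positivity

/-- `fₖ(x) = (1/2) π⁻³ (∫ exp (i ⟨p, x̲⟩) / ((|p|² + k²) (|p|² + k² - Eₖ)) dp sin (k x₁)`
`+ (2 βₖ Eₖ)⁻¹ ln (k² / (k² - Eₖ)) ∫ exp (i ⟨p, x̲⟩) / (|p|² + k²) dp sin (k x₁))`. -/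
def eigenvector (α : ℝ) (k : ℕ+) : L2Ω :=
  mode k (toL2Plane fun p =>
    (((‖p‖ ^ 2 + (k : ℕ) ^ 2) * (‖p‖ ^ 2 + (k : ℕ) ^ 2 - energy α k) : ℝ)⁻¹ : ℝ)) +
  (((2 * β α k * energy α k)⁻¹ *
    Real.log ((k : ℕ) ^ 2 / ((k : ℕ) ^ 2 - energy α k)) : ℝ) : ℂ) •
      mode k (toL2Plane fun p => ((‖p‖ ^ 2 + (k : ℕ) ^ 2 : ℝ)⁻¹ : ℝ))

end SingularLaplace

end

noncomputable section

namespace SingularLaplace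

/-! ### Radial integrals over the plane -/

/-! The subspaces L²(ℝ²) ⊗ sin kx₁ are mutually orthogonal (`inner_mode`), and the perturbation has
rank one in each of them. If x and b are the symbols in mode k of a vector in the domain of Ã and of
its image, then b = (|p|² + k²) x - κ, where the constant κ = `coupling α k b` depends linearly on b
(`exists_of_mem_graph_perturbedInverse`; `mem_graph_perturbedInverse_mode` is the converse for a
single mode).

The equation Ãf = Ef thus reads (|p|² + k² - E) x = κ in every mode. A nonzero square integrable
solution exists only for E < k², and then x = κ / (|p|² + k² - E). Inserting this into the formula
for κ leaves the scalar condition that E times the coupling of 1 / (|p|² + k² - E) be 1. The radial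
integral `integral_radial_inv` turns it into ln (k² / (k² - E)) = 2βₖ, that is E = Eₖ
(`eigenvector_component`). Since Eₖ → ∞, a given E occurs in finitely many modes only, so its
eigenvectors are finite sums of the fₖ.

For the absolutely continuous spectrum, a symbol odd in p has coupling 0, so on odd symbols in mode
1 the operator is multiplication by |p|² + 1. This gives a vector η with absolutely continuous
spectral measure. For E ≥ 1 the equation (Ã - E) f = η has no solution: the odd part of f in mode 1
would be η / (|p|² + 1 - E), which is not square integrable. Hence every E ≥ 1 qualifies, in
particular Eₖ for large k. -/

lemma integral_radial_inv {a b : ℝ} (ha : 0 < a) (hb : 0 < b) (hab : a ≠ b) :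
    ∫ p : Plane, ((‖p‖ ^ 2 + a) * (‖p‖ ^ 2 + b))⁻¹ = Real.pi / (b - a) * Real.log (b / a) := by
  have hba : b - a ≠ 0 := sub_ne_zero.2 hab.symm
  have hball : (volume : Measure Plane).real (Metric.ball 0 1) = Real.pi := by
    simp [measureReal_def, EuclideanSpace.volume_ball_fin_two, Real.pi_pos.le]
  -- Antiderivative of the radial integrand, by partial fractions in r².
  have hd : ∀ x ∈ Set.Ici (0 : ℝ), HasDerivAt
      (fun r : ℝ => (2 * (b - a))⁻¹ * (Real.log (r ^ 2 + a) - Real.log (r ^ 2 + b)))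
      (x * ((x ^ 2 + a) * (x ^ 2 + b))⁻¹) x := by
    intro x _
    have h1 : x ^ 2 + a ≠ 0 := by positivity
    have h2 : x ^ 2 + b ≠ 0 := by positivity
    have hp : ∀ c : ℝ, HasDerivAt (fun r : ℝ => r ^ 2 + c) (2 * x) x := fun c => by
      simpa using (hasDerivAt_pow 2 x).add_const c
    have h := (((hp a).log h1).sub ((hp b).log h2)).const_mul (2 * (b - a))⁻¹
    refine h.congr_deriv ?_
    field_simp
    ring
  have ht : Tendsto
      (fun r : ℝ => (2 * (b - a))⁻¹ * (Real.log (r ^ 2 + a) - Real.log (r ^ 2 + b)))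
      atTop (𝓝 0) := by
    have hq : Tendsto (fun r : ℝ => (r ^ 2 + a) / (r ^ 2 + b)) atTop (𝓝 1) := by
      have h3 : Tendsto (fun r : ℝ => 1 + (a - b) / (r ^ 2 + b)) atTop (𝓝 (1 + 0)) :=
        ((tendsto_const_nhds).div_atTop
          (tendsto_atTop_add_const_right _ b (tendsto_pow_atTop two_ne_zero))).const_add 1
      rw [add_zero] at h3
      refine h3.congr fun r => ?_
      have : r ^ 2 + b ≠ 0 := by positivity
      field_simp
      ring
    have h4 := ((Real.continuousAt_log one_ne_zero).tendsto.comp hq).const_mul (2 * (b - a))⁻¹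
    rw [Real.log_one, mul_zero] at h4
    refine h4.congr fun r => ?_
    rw [Function.comp_apply, Real.log_div (by positivity) (by positivity)]
  have hI := integral_Ioi_of_hasDerivAt_of_nonneg' hd
    (fun x hx => by have : 0 < x := hx; positivity) ht
  -- Polar coordinates contribute the dimension times the volume of the unit ball, 2π.
  rw [integral_fun_norm_addHaar volume (fun r : ℝ => ((r ^ 2 + a) * (r ^ 2 + b))⁻¹), hball]
  simp only [finrank_euclideanSpace, Fintype.card_fin, Nat.add_one_sub_one, pow_one, smul_eq_mul]
  rw [hI, Real.log_div hb.ne' ha.ne']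
  simp only [nsmul_eq_mul]
  field_simp
  push_cast
  simp

/-- With b = -c² the radial integrand r / (r² - c²)² has the antiderivative -1 / (2 (r² - c²)),
which is unbounded as r decreases to c. This excludes eigenvalues E ≥ k² and also yields the
continuous spectrum. -/
lemma not_memLp_inv_of_nonpos {b : ℝ} (hb : b ≤ 0) :
    ¬ MemLp (fun p : Plane => (((‖p‖ ^ 2 + b : ℝ)⁻¹ : ℝ) : ℂ)) 2 volume := by
  have hm : Measurable (fun p : Plane => (((‖p‖ ^ 2 + b : ℝ)⁻¹ : ℝ) : ℂ)) :=
    Complex.measurable_ofReal.comp ((measurable_norm.pow_const 2).add_const b).inv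
  rw [memLp_two_iff_integrable_sq_norm hm.aestronglyMeasurable]
  intro h
  have h1 : Integrable (fun p : Plane => ((fun r : ℝ => (((r ^ 2 + b))⁻¹) ^ 2) ‖p‖)) volume :=
    h.congr (Eventually.of_forall fun p => by
      simp only []
      rw [Complex.norm_real, Real.norm_eq_abs, sq_abs])
  rw [integrable_fun_norm_addHaar volume (f := fun r : ℝ => (((r ^ 2 + b))⁻¹) ^ 2)] at h1
  simp only [finrank_euclideanSpace, Fintype.card_fin, Nat.add_one_sub_one, pow_one,
    smul_eq_mul] at h1
  obtain ⟨c, hc, rfl⟩ : ∃ c : ℝ, 0 ≤ c ∧ b = -c ^ 2 :=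
    ⟨√(-b), Real.sqrt_nonneg _, by rw [Real.sq_sqrt (by linarith)]; ring⟩
  have hpos : ∀ x : ℝ, c < x → 0 < x ^ 2 - c ^ 2 := fun x hx => by nlinarith
  have hder : ∀ x : ℝ, c < x → HasDerivAt (fun r : ℝ => -(2 * (r ^ 2 - c ^ 2))⁻¹)
      (x * ((x ^ 2 + -c ^ 2)⁻¹) ^ 2) x := by
    intro x hx
    have h2 := (hpos x hx).ne'
    have h3 : x ^ 2 + -c ^ 2 ≠ 0 := by rwa [← sub_eq_add_neg]
    have h := ((((hasDerivAt_pow 2 x).sub_const (c ^ 2)).const_mul 2).inv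
      (mul_ne_zero two_ne_zero h2)).neg
    refine h.congr_deriv ?_
    rw [← sub_eq_add_neg]
    field_simp
    simp
  refine not_integrableOn_of_tendsto_norm_atTop_of_deriv_isBigO_filter (k := Set.Ioi 0)
    (f := fun r : ℝ => -(2 * (r ^ 2 - c ^ 2))⁻¹) (𝓝[>] c) ?_ ?_ ?_ ?_ h1
  · filter_upwards [self_mem_nhdsWithin] with x hx
    exact hc.trans_lt hx
  · filter_upwards [self_mem_nhdsWithin] with x hx
    exact (hder x hx).differentiableAt
  · simp only [norm_neg, norm_inv]
    refine Tendsto.inv_tendsto_nhdsGT_zero ?_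
    refine tendsto_nhdsWithin_iff.2 ⟨?_, ?_⟩
    · have : Continuous fun x : ℝ => ‖2 * (x ^ 2 - c ^ 2)‖ := by fun_prop
      have := this.tendsto c
      simp only [sub_self, mul_zero, norm_zero] at this
      exact this.mono_left nhdsWithin_le_nhds
    · filter_upwards [self_mem_nhdsWithin] with x hx
      have := (hpos x hx).ne'
      exact norm_pos_iff.2 (by simpa using this)
  · refine EventuallyEq.isBigO ?_
    filter_upwards [self_mem_nhdsWithin] with x hx
    exact (hder x hx).deriv

lemma ae_norm_sq_add_ne_zero (b : ℝ) : ∀ᵐ p : Plane, ‖p‖ ^ 2 + b ≠ 0 := by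
  -- For b > 0 the square root is 0 and the sphere is a point, still a null set.
  have h0 : (volume : Measure Plane) (Metric.sphere 0 √(-b)) = 0 := Measure.addHaar_sphere _ _ _
  filter_upwards [measure_eq_zero_iff_ae_notMem.1 h0] with p hp h
  refine hp ?_
  rw [mem_sphere_zero_iff_norm, show -b = ‖p‖ ^ 2 by linarith, Real.sqrt_sq (norm_nonneg _)]

/-- The radii r with r² + b in a null set form the image of a null set under a square root,
differentiable away from its branch point, hence a null set. Polar coordinates carry this over to
the plane. -/
lemma map_norm_sq_add_absolutelyContinuous (b : ℝ) :
    Measure.map (fun p : Plane => ‖p‖ ^ 2 + b) volume ≪ volume := by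
  refine Measure.AbsolutelyContinuous.mk fun t ht h0 => ?_
  have hm : Measurable (fun p : Plane => ‖p‖ ^ 2 + b) :=
    (measurable_norm.pow_const 2).add_const b
  rw [Measure.map_apply hm ht]
  set N : Set ℝ := (fun x => √(x - b)) '' (t ∩ Set.Ioi b) with hN
  have hN0 : volume N = 0 := by
    refine addHaar_image_eq_zero_of_differentiableOn_of_addHaar_eq_zero volume ?_
      (measure_mono_null Set.inter_subset_left h0)
    intro x hx
    have : x - b ≠ 0 := (sub_pos.2 hx.2).ne'
    exact ((differentiableAt_id.sub_const b).sqrt this).differentiableWithinAt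
  have hz : (fun y : ℝ => y ^ (Module.finrank ℝ Plane - 1) • N.indicator (fun _ => (1 : ℝ)) y)
      =ᵐ[volume.restrict (Set.Ioi 0)] 0 := by
    filter_upwards [ae_restrict_of_ae (measure_eq_zero_iff_ae_notMem.1 hN0)] with y hy
    simp [hy]
  have hi : Integrable (fun p : Plane => N.indicator (fun _ => (1 : ℝ)) ‖p‖) volume := by
    rw [integrable_fun_norm_addHaar volume]
    exact (integrable_zero _ _ _).congr hz.symm
  have h1 : ∫ p : Plane, N.indicator (fun _ => (1 : ℝ)) ‖p‖ = 0 := by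
    rw [integral_fun_norm_addHaar volume, integral_congr_ae hz]
    simp
  rw [integral_eq_zero_iff_of_nonneg
    (fun p => Set.indicator_nonneg (fun _ _ => zero_le_one) _) hi] at h1
  have h2 : ∀ᵐ p : Plane, ¬ (‖p‖ ^ 2 + b ∈ t) := by
    filter_upwards [h1, ae_norm_sq_add_ne_zero 0] with p hp hp0 hpt
    have hmem : ‖p‖ ∈ N := by
      refine ⟨‖p‖ ^ 2 + b, ⟨hpt, ?_⟩, by simp⟩
      have : 0 < ‖p‖ ^ 2 := by
        rw [add_zero] at hp0
        positivity
      simpa using this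
    simp [hmem] at hp
  exact measure_eq_zero_iff_ae_notMem.2 h2

/-! ### Orthogonality of the modes -/

lemma integral_sin_mul_sin (k j : ℕ+) :
    ∫ x in Set.Ioo 0 Real.pi, Real.sin ((k : ℕ) * x) * Real.sin ((j : ℕ) * x) =
      if k = j then Real.pi / 2 else 0 := by
  have hcos : ∀ n : ℤ, ∫ x in (0 : ℝ)..Real.pi, Real.cos (n * x) = if n = 0 then Real.pi else 0 := by
    intro n
    split_ifs with hn
    · simp [hn]
    · have hn' : (n : ℝ) ≠ 0 := by exact_mod_cast hn
      rw [intervalIntegral.integral_comp_mul_left _ hn', integral_cos]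
      simp [Real.sin_int_mul_pi]
  have hsum : ((k : ℕ) : ℤ) + (j : ℕ) ≠ 0 := by
    have := k.pos
    omega
  have hsub : ((k : ℕ) : ℤ) - (j : ℕ) = 0 ↔ k = j := by
    rw [sub_eq_zero, Nat.cast_inj, PNat.coe_inj]
  have hint : ∀ n : ℤ, IntervalIntegrable (fun x : ℝ => Real.cos (n * x)) volume 0 Real.pi :=
    fun n => Continuous.intervalIntegrable (by fun_prop) _ _
  rw [← integral_Ioc_eq_integral_Ioo, ← intervalIntegral.integral_of_le Real.pi_pos.le]
  have heq : ∀ x : ℝ, Real.sin ((k : ℕ) * x) * Real.sin ((j : ℕ) * x) =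
      (Real.cos ((((k : ℕ) : ℤ) - (j : ℕ) : ℤ) * x) -
        Real.cos ((((k : ℕ) : ℤ) + (j : ℕ) : ℤ) * x)) / 2 := by
    intro x
    push_cast
    rw [sub_mul, add_mul, Real.cos_sub, Real.cos_add]
    ring
  simp_rw [heq]
  rw [intervalIntegral.integral_div, intervalIntegral.integral_sub (hint _) (hint _), hcos, hcos,
    if_neg hsum, sub_zero]
  by_cases hkj : k = j
  · simp [hkj]
  · rw [if_neg hkj, if_neg (mt hsub.1 hkj), zero_div]

/-- Plancherel in the plane and orthogonality of the sines. The constant is (2π³)⁻² · (π/2) · (2π)²,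
the last factor coming from the dilation by 1 / (2π). -/
lemma inner_mode (k j : ℕ+) (g h : L2Plane) :
    inner ℂ (mode k g) (mode j h) =
      if k = j then ((2 * Real.pi ^ 3)⁻¹ : ℝ) * inner ℂ g h else (0 : ℂ) := by
  have hg : (mode k g : ℝ × Plane → ℂ) =ᵐ[volΩ] modeFun k g := (memLp_modeFun k g).coeFn_toLp
  have hh : (mode j h : ℝ × Plane → ℂ) =ᵐ[volΩ] modeFun j h := (memLp_modeFun j h).coeFn_toLp
  have hpl : inner ℂ (𝓕⁻ g : L2Plane) (𝓕⁻ h : L2Plane) = inner ℂ g h := by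
    rw [← Lp.inner_fourier_eq, FourierTransform.fourier_fourierInv_eq,
      FourierTransform.fourier_fourierInv_eq]
  have hfun : ∀ x : ℝ × Plane, inner ℂ (modeFun k g x) (modeFun j h x) =
      (((Real.sin ((k : ℕ) * x.1) * Real.sin ((j : ℕ) * x.1) : ℝ) : ℂ)) *
        ((2 * (Real.pi : ℂ) ^ 3)⁻¹ ^ 2 *
          (fun y : Plane => inner ℂ ((𝓕⁻ g : L2Plane) y) ((𝓕⁻ h : L2Plane) y))
            ((2 * Real.pi)⁻¹ • x.2)) := by
    intro x
    simp only [modeFun, RCLike.inner_apply, map_mul, map_inv₀, map_pow, Complex.conj_ofReal,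
      map_ofNat, Complex.ofReal_mul]
    ring
  rw [L2.inner_def]
  have h1 : ∫ x, inner ℂ ((mode k g : ℝ × Plane → ℂ) x) ((mode j h : ℝ × Plane → ℂ) x) ∂volΩ =
      ∫ x, inner ℂ (modeFun k g x) (modeFun j h x) ∂volΩ := by
    refine integral_congr_ae ?_
    filter_upwards [hg, hh] with x h2 h3
    rw [h2, h3]
  rw [h1]
  simp_rw [hfun]
  rw [volΩ, integral_prod_mul (L := ℂ)
    (fun x : ℝ => ((Real.sin ((k : ℕ) * x) * Real.sin ((j : ℕ) * x) : ℝ) : ℂ))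
    (fun y : Plane => (2 * (Real.pi : ℂ) ^ 3)⁻¹ ^ 2 *
          (fun y : Plane => inner ℂ ((𝓕⁻ g : L2Plane) y) ((𝓕⁻ h : L2Plane) y))
            ((2 * Real.pi)⁻¹ • y)), integral_complex_ofReal, integral_sin_mul_sin,
    integral_const_mul, Measure.integral_comp_inv_smul volume
      (fun y : Plane => inner ℂ ((𝓕⁻ g : L2Plane) y) ((𝓕⁻ h : L2Plane) y)), ← L2.inner_def, hpl]
  split_ifs
  · have hpi : (Real.pi : ℂ) ≠ 0 := by exact_mod_cast Real.pi_ne_zero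
    simp only [finrank_euclideanSpace, Fintype.card_fin, abs_of_pos Real.pi_pos, abs_mul, abs_pow,
      Nat.abs_ofNat, Complex.real_smul]
    push_cast
    field_simp
  · simp

/-! ### Coefficients of a series of modes -/

lemma inner_mode_of_hasSum {a : ℕ+ → L2Plane} {w : L2Ω} (h : HasSum (fun k => mode k (a k)) w)
    (j : ℕ+) (g : L2Plane) :
    inner ℂ (mode j g) w = ((2 * Real.pi ^ 3)⁻¹ : ℝ) * inner ℂ g (a j) := by
  have h1 := h.mapL (innerSL ℂ (mode j g))
  refine h1.unique ?_
  have h2 := hasSum_single (f := fun k => innerSL ℂ (mode j g) (mode k (a k))) j fun k hk => by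
    rw [innerSL_apply_apply, inner_mode, if_neg hk.symm]
  have h3 : innerSL ℂ (mode j g) (mode j (a j)) =
      ((2 * Real.pi ^ 3)⁻¹ : ℝ) * inner ℂ g (a j) := by
    rw [innerSL_apply_apply, inner_mode, if_pos rfl]
  exact h3 ▸ h2

lemma eq_of_hasSum_mode {a b : ℕ+ → L2Plane} {w : L2Ω} (ha : HasSum (fun k => mode k (a k)) w)
    (hb : HasSum (fun k => mode k (b k)) w) (k : ℕ+) : a k = b k := by
  refine ext_inner_left ℂ fun g => ?_
  have h := (inner_mode_of_hasSum ha k g).symm.trans (inner_mode_of_hasSum hb k g)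
  have h0 : (((2 * Real.pi ^ 3)⁻¹ : ℝ) : ℂ) ≠ 0 := by
    rw [Complex.ofReal_ne_zero]
    positivity
  exact mul_left_cancel₀ h0 h

lemma hasSum_mode_single (k : ℕ+) (x : L2Plane) :
    HasSum (fun j => mode j ((Pi.single k x : ℕ+ → L2Plane) j)) (mode k x) := by
  have h := hasSum_single (f := fun j => mode j ((Pi.single k x : ℕ+ → L2Plane) j)) k
    fun j hj => by rw [Pi.single_eq_of_ne hj, map_zero]
  rwa [Pi.single_eq_same] at h

lemma mode_injective (k : ℕ+) : Function.Injective (mode k) := by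
  intro x y hxy
  have h := eq_of_hasSum_mode (hasSum_mode_single k x) (hxy ▸ hasSum_mode_single k y) k
  simpa using h

/-! ### The functions `1 / (|p|² + b)` -/

/-- The element `1 / (|p|² + b)` of `L²(ℝ²)`. -/
def resolventSymbol (b : ℝ) : L2Plane :=
  toL2Plane fun p => (((‖p‖ ^ 2 + b : ℝ)⁻¹ : ℝ) : ℂ)

lemma coeFn_toL2Plane {h : Plane → ℂ} (hh : MemLp h 2 volume) : toL2Plane h =ᵐ[volume] h := by
  rw [toL2Plane, dif_pos hh]
  exact hh.coeFn_toLp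

lemma coeFn_resolventSymbol {b : ℝ} (hb : 0 < b) :
    resolventSymbol b =ᵐ[volume] fun p : Plane => (((‖p‖ ^ 2 + b : ℝ)⁻¹ : ℝ) : ℂ) :=
  coeFn_toL2Plane (memLp_symbol hb hb).1

lemma sq_pos (k : ℕ+) : (0 : ℝ) < ((k : ℕ) : ℝ) ^ 2 := by
  have := k.pos
  positivity

lemma e_eq (k : ℕ+) : e k = mode k (resolventSymbol ((k : ℕ) ^ 2)) := rfl

lemma inner_resolventSymbol {a b : ℝ} (ha : 0 < a) (hb : 0 < b) (hab : a ≠ b) :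
    inner ℂ (resolventSymbol a) (resolventSymbol b) =
      ((Real.pi / (b - a) * Real.log (b / a) : ℝ) : ℂ) := by
  rw [L2.inner_def, ← integral_radial_inv ha hb hab, ← integral_complex_ofReal]
  refine integral_congr_ae ?_
  filter_upwards [coeFn_resolventSymbol ha, coeFn_resolventSymbol hb] with p h1 h2
  rw [h1, h2, RCLike.inner_apply, Complex.conj_ofReal, mul_inv, mul_comm]
  push_cast
  rfl

/-- The square integrable solutions of `(|p|² + b) x = κ`. -/
lemma eq_smul_resolventSymbol {b : ℝ} {κ : ℂ} {x : L2Plane}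
    (h : ∀ᵐ p : Plane, ((‖p‖ ^ 2 + b : ℝ) : ℂ) * x p = κ) :
    (κ = 0 ∧ x = 0) ∨ (0 < b ∧ x = κ • resolventSymbol b) := by
  have hx : x =ᵐ[volume] fun p : Plane => κ * (((‖p‖ ^ 2 + b : ℝ)⁻¹ : ℝ) : ℂ) := by
    filter_upwards [h, ae_norm_sq_add_ne_zero b] with p hp hp0
    have : ((‖p‖ ^ 2 + b : ℝ) : ℂ) ≠ 0 := Complex.ofReal_ne_zero.2 hp0
    rw [← hp, Complex.ofReal_inv]
    field_simp
  by_cases hκ : κ = 0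
  · refine Or.inl ⟨hκ, ?_⟩
    refine (Lp.eq_zero_iff_ae_eq_zero).2 ?_
    filter_upwards [hx] with p hp
    rw [hp, hκ, zero_mul, Pi.zero_apply]
  · have hb : 0 < b := by
      by_contra hb
      refine not_memLp_inv_of_nonpos (not_lt.1 hb) ?_
      have h1 := ((memLp_congr_ae hx).1 (Lp.memLp x)).const_mul κ⁻¹
      refine (memLp_congr_ae (Eventually.of_forall fun p => ?_)).1 h1
      simp [hκ]
    refine Or.inr ⟨hb, ?_⟩
    refine Lp.ext ?_
    filter_upwards [hx, Lp.coeFn_smul κ (resolventSymbol b), coeFn_resolventSymbol hb]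
      with p h1 h2 h3
    rw [h1, h2, Pi.smul_apply, h3, smul_eq_mul]

/-- The plane has infinite measure, so the only square integrable constant is 0. -/
lemma eq_zero_of_ae_eq_const {κ : ℂ} {x : L2Plane} (h : ∀ᵐ p : Plane, x p = κ) : x = 0 := by
  have h1 : MemLp (fun _ : Plane => κ) 2 volume := (memLp_congr_ae h).1 (Lp.memLp x)
  rw [memLp_const_iff two_ne_zero ENNReal.ofNat_ne_top] at h1
  have h2 : κ = 0 := by simpa using h1
  refine (Lp.eq_zero_iff_ae_eq_zero).2 ?_
  filter_upwards [h] with p hp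
  rw [hp, h2, Pi.zero_apply]

/-! ### Graphs of the operators -/

/-- `Submodule.toLinearPMap` has the given graph only if that graph is single valued; uniqueness of
mode coefficients provides this. -/
lemma dirichletLaplacian_graph : dirichletLaplacian.graph = dirichletGraph := by
  refine Submodule.toLinearPMap_graph_eq _ ?_
  rintro ⟨u, v⟩ ⟨a, b, hab, ha, hb⟩ (rfl : u = 0)
  have ha0 : ∀ k, a k = 0 := eq_of_hasSum_mode ha (b := 0) (by simp)
  have hb0 : ∀ k, b k = 0 := fun k => by
    refine (Lp.eq_zero_iff_ae_eq_zero).2 ?_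
    filter_upwards [hab k, Lp.coeFn_zero ℂ 2 (volume : Measure Plane)] with p h1 h2
    rw [h1, ha0, h2, Pi.zero_apply, mul_zero]
  refine hb.unique ?_
  simp [hb0]

lemma dirichletLaplacian_ker : dirichletLaplacian.toFun.ker = ⊥ := by
  refine LinearMap.ker_eq_bot'.2 fun u hu => ?_
  have h : ((u : L2Ω), dirichletLaplacian u) ∈ dirichletGraph :=
    dirichletLaplacian_graph ▸ dirichletLaplacian.mem_graph u
  obtain ⟨a, b, hab, ha, hb⟩ := h
  have hu' : dirichletLaplacian u = 0 := hu
  simp only [hu'] at hb ha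
  have hb0 : ∀ k, b k = 0 := eq_of_hasSum_mode hb (b := 0) (by simp)
  have ha0 : ∀ k, a k = 0 := fun k => by
    refine (Lp.eq_zero_iff_ae_eq_zero).2 ?_
    filter_upwards [hab k, Lp.coeFn_zero ℂ 2 (volume : Measure Plane),
      ae_norm_sq_add_ne_zero ((k : ℕ) ^ 2)] with p h1 h2 h3
    rw [hb0, h2, Pi.zero_apply] at h1
    exact (mul_eq_zero.1 h1.symm).resolve_left (Complex.ofReal_ne_zero.2 h3)
  refine Subtype.ext (ha.unique ?_)
  simp [ha0]

lemma mem_graph_inverse {T : L2Ω →ₗ.[ℂ] L2Ω} (hT : T.toFun.ker = ⊥) {f g : L2Ω} :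
    (f, g) ∈ T.inverse.graph ↔ (g, f) ∈ T.graph := by
  rw [LinearPMap.inverse_graph hT, Submodule.mem_map]
  constructor
  · rintro ⟨⟨u, v⟩, h, h'⟩
    obtain ⟨rfl, rfl⟩ := Prod.mk.inj h'
    exact h
  · exact fun h => ⟨(g, f), h, rfl⟩

/-- The inverse of `perturbedLaplacian α`. -/
abbrev perturbedInverse (α : ℝ) : L2Ω →ₗ.[ℂ] L2Ω := dirichletLaplacian.inverse + perturbation α

lemma mem_graph_perturbedInverse {α : ℝ} {f g : L2Ω} :
    (g, f) ∈ (perturbedInverse α).graph ↔ ∃ u, (u, g) ∈ dirichletGraph ∧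
      (Summable fun k => ((coeff α k : ℂ) * inner ℂ (e k) g) • e k) ∧
      f = u + ∑' k, ((coeff α k : ℂ) * inner ℂ (e k) g) • e k := by
  rw [← dirichletLaplacian_graph]
  simp_rw [← mem_graph_inverse dirichletLaplacian_ker]
  constructor
  · intro h
    obtain ⟨⟨y, hy⟩, rfl, hf⟩ := (LinearPMap.mem_graph_iff _).1 h
    refine ⟨dirichletLaplacian.inverse ⟨y, hy.1⟩, dirichletLaplacian.inverse.mem_graph ⟨y, hy.1⟩, hy.2, ?_⟩
    exact hf.symm
  · rintro ⟨u, hu, hs, rfl⟩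
    obtain ⟨⟨y, hy⟩, rfl, hf⟩ := (LinearPMap.mem_graph_iff _).1 hu
    refine (LinearPMap.mem_graph_iff _).2 ⟨⟨y, hy, hs⟩, rfl, ?_⟩
    exact congrArg (· + ∑' k, ((coeff α k : ℂ) * inner ℂ (e k) y) • e k) hf

/-- The value at mode `k` of the functional by which the perturbation acts. -/
def coupling (α : ℝ) (k : ℕ+) (b : L2Plane) : ℂ :=
  (coeff α k : ℂ) * (((2 * Real.pi ^ 3)⁻¹ : ℝ) * inner ℂ (resolventSymbol ((k : ℕ) ^ 2)) b)

lemma coupling_smul (α : ℝ) (k : ℕ+) (c : ℂ) (b : L2Plane) :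
    coupling α k (c • b) = c * coupling α k b := by
  rw [coupling, coupling, inner_smul_right]
  ring

/-- If a is the symbol of A⁻¹g in mode k, then f has the symbol x = a + κ / (|p|² + k²); multiplying
by |p|² + k² leaves the constant κ. Here the singular perturbation becomes an additive constant in
momentum space. -/
lemma exists_of_mem_graph_perturbedInverse {α : ℝ} {f g : L2Ω}
    (h : (g, f) ∈ (perturbedInverse α).graph) :
    ∃ x b : ℕ+ → L2Plane, HasSum (fun k => mode k (x k)) f ∧ HasSum (fun k => mode k (b k)) g ∧
      ∀ k, ∀ᵐ p : Plane,
        b k p = ((‖p‖ ^ 2 + (k : ℕ) ^ 2 : ℝ) : ℂ) * x k p - coupling α k (b k) := by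
  obtain ⟨u, ⟨a, b, hab, ha, hb⟩, hs, rfl⟩ := mem_graph_perturbedInverse.1 h
  refine ⟨fun k => a k + coupling α k (b k) • resolventSymbol ((k : ℕ) ^ 2), b, ?_, hb,
    fun k => ?_⟩
  · refine (ha.add hs.hasSum).congr_fun fun k => ?_
    rw [map_add, map_smul, e_eq, inner_mode_of_hasSum hb, coupling]
  · filter_upwards [hab k, Lp.coeFn_add (a k) (coupling α k (b k) • resolventSymbol ((k : ℕ) ^ 2)),
      Lp.coeFn_smul (coupling α k (b k)) (resolventSymbol ((k : ℕ) ^ 2)),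
      coeFn_resolventSymbol (sq_pos k), ae_norm_sq_add_ne_zero ((k : ℕ) ^ 2)] with p h1 h2 h3 h4 h5
    have h6 := Complex.ofReal_ne_zero.2 h5
    rw [h1, h2, Pi.add_apply, h3, Pi.smul_apply, h4, smul_eq_mul, Complex.ofReal_inv]
    field_simp
    ring

/-- With a single mode present, the series over k have one nonzero term, so no convergence question
arises. -/
lemma mem_graph_perturbedInverse_mode {α : ℝ} {k : ℕ+} {x b : L2Plane}
    (h : ∀ᵐ p : Plane, b p = ((‖p‖ ^ 2 + (k : ℕ) ^ 2 : ℝ) : ℂ) * x p - coupling α k b) :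
    (mode k b, mode k x) ∈ (perturbedInverse α).graph := by
  have hb := hasSum_mode_single k b
  have hz : ∀ j, ((coeff α j : ℂ) * inner ℂ (e j) (mode k b)) • e j =
      mode j ((Pi.single k (coupling α k b • resolventSymbol ((k : ℕ) ^ 2)) : ℕ+ → L2Plane) j) := by
    intro j
    rw [e_eq, inner_mode_of_hasSum hb]
    rcases eq_or_ne j k with rfl | hj
    · rw [Pi.single_eq_same, Pi.single_eq_same, map_smul, coupling]
    · rw [Pi.single_eq_of_ne hj, Pi.single_eq_of_ne hj]
      simp
  have hsum := hasSum_mode_single k (coupling α k b • resolventSymbol ((k : ℕ) ^ 2))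
  refine mem_graph_perturbedInverse.2
    ⟨mode k (x - coupling α k b • resolventSymbol ((k : ℕ) ^ 2)),
      ⟨Pi.single k (x - coupling α k b • resolventSymbol ((k : ℕ) ^ 2)), Pi.single k b, fun j => ?_,
        hasSum_mode_single _ _, hb⟩, ?_, ?_⟩
  · rcases eq_or_ne j k with rfl | hj
    · rw [Pi.single_eq_same, Pi.single_eq_same]
      filter_upwards [h, Lp.coeFn_sub x (coupling α j b • resolventSymbol ((j : ℕ) ^ 2)),
        Lp.coeFn_smul (coupling α j b) (resolventSymbol ((j : ℕ) ^ 2)),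
        coeFn_resolventSymbol (sq_pos j), ae_norm_sq_add_ne_zero ((j : ℕ) ^ 2)]
        with p h1 h2 h3 h4 h5
      have h6 := Complex.ofReal_ne_zero.2 h5
      rw [h1, h2, Pi.sub_apply, h3, Pi.smul_apply, h4, smul_eq_mul, Complex.ofReal_inv]
      field_simp
    · rw [Pi.single_eq_of_ne hj, Pi.single_eq_of_ne hj]
      filter_upwards [Lp.coeFn_zero ℂ 2 (volume : Measure Plane)] with p hp
      rw [hp, Pi.zero_apply, mul_zero]
  · simp_rw [hz]
    exact hsum.summable
  · simp_rw [hz]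
    rw [hsum.tsum_eq, map_sub, sub_add_cancel]

/-- A vector in the kernel has a constant symbol in each mode, hence vanishes. This makes
`LinearPMap.inverse` a genuine inverse. -/
lemma perturbedInverse_ker (α : ℝ) : (perturbedInverse α).toFun.ker = ⊥ := by
  refine LinearMap.ker_eq_bot'.2 fun g hg => ?_
  have h := (perturbedInverse α).mem_graph g
  have hg' : perturbedInverse α g = 0 := hg
  rw [hg'] at h
  obtain ⟨x, b, hx, hb, hxb⟩ := exists_of_mem_graph_perturbedInverse h
  have hx0 : ∀ k, x k = 0 := eq_of_hasSum_mode hx (b := 0) (by simp)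
  have hb0 : ∀ k, b k = 0 := fun k => by
    refine eq_zero_of_ae_eq_const (κ := -coupling α k (b k)) ?_
    filter_upwards [hxb k, Lp.coeFn_zero ℂ 2 (volume : Measure Plane)] with p h1 h2
    rw [h1, hx0, h2, Pi.zero_apply, mul_zero, zero_sub]
  refine Subtype.ext (hb.unique ?_)
  simp [hb0]

lemma mem_graph_perturbedLaplacian {α : ℝ} {f g : L2Ω} :
    (f, g) ∈ (perturbedLaplacian α).graph ↔ (g, f) ∈ (perturbedInverse α).graph :=
  mem_graph_inverse (perturbedInverse_ker α)

/-! ### Eigenvalues and eigenvectors -/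

section Eigenvalues

variable {α : ℝ} (hα : α ≠ 0) {k : ℕ+} (hs : 1 + α * (k : ℕ) ^ 2 * s k ≠ 0)

lemma sq_sub_energy (α : ℝ) (k : ℕ+) :
    (k : ℕ) ^ 2 - energy α k = (k : ℕ) ^ 2 * Real.exp (-2 * β α k) := by
  unfold energy
  ring

lemma log_div_sq_sub_energy (α : ℝ) (k : ℕ+) :
    Real.log ((k : ℕ) ^ 2 / ((k : ℕ) ^ 2 - energy α k)) = 2 * β α k := by
  rw [sq_sub_energy, div_mul_cancel_left₀ (sq_pos k).ne', ← Real.exp_neg, Real.log_exp]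
  ring

include hα in
-- This identity is the origin of βₖ: it turns the strength of the rank one term into π² / βₖ.
lemma coeff_mul_β (hs : 1 + α * (k : ℕ) ^ 2 * s k ≠ 0) : coeff α k * β α k = Real.pi ^ 2 := by
  have hk := (sq_pos k).ne'
  have hs' : 1 + s k * α * (k : ℕ) ^ 2 ≠ 0 := by
    rwa [show s k * α * (k : ℕ) ^ 2 = α * (k : ℕ) ^ 2 * s k by ring]
  have h : 1 + α * (k : ℕ) ^ 2 * s k = 1 + s k * α * (k : ℕ) ^ 2 := by ring
  rw [coeff, β, h]
  field_simp

include hα hs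

lemma β_ne_zero : β α k ≠ 0 := by
  intro h
  have := coeff_mul_β hα hs
  rw [h, mul_zero] at this
  exact pow_ne_zero 2 Real.pi_ne_zero this.symm

lemma energy_ne_zero : energy α k ≠ 0 := by
  intro h
  have h1 := log_div_sq_sub_energy α k
  rw [h, sub_zero, div_self (sq_pos k).ne', Real.log_one] at h1
  exact β_ne_zero hα hs (by linarith)

/-- For `E < k²`, `E ≠ 0`, the coupling of `E / (|p|² + k² - E)` is `1` exactly if `E = Eₖ`. -/
lemma coupling_resolventSymbol {E : ℝ} (hE : E ≠ 0) (hEk : 0 < (k : ℕ) ^ 2 - E) :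
    (E : ℂ) * coupling α k (resolventSymbol ((k : ℕ) ^ 2 - E)) =
      (((2 * β α k)⁻¹ * Real.log ((k : ℕ) ^ 2 / ((k : ℕ) ^ 2 - E)) : ℝ) : ℂ) := by
  have hk := sq_pos k
  rw [coupling, inner_resolventSymbol hk hEk (fun h => hE (by linarith))]
  -- The prefactor E cancels against b - a = -E in the radial integral, and what remains is π² / βₖ
  -- divided by 2π².
  have hc : coeff α k = Real.pi ^ 2 / β α k := by
    rw [← coeff_mul_β hα hs, mul_div_cancel_right₀ _ (β_ne_zero hα hs)]
  have hβ := β_ne_zero hα hs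
  have hpi := Real.pi_ne_zero
  have hne : (k : ℕ) ^ 2 - E - (k : ℕ) ^ 2 ≠ 0 := fun h => hE (by linarith)
  norm_cast
  simp only [PNat.pow_coe, Nat.cast_pow]
  rw [hc, Real.log_div hk.ne' hEk.ne', Real.log_div hEk.ne' hk.ne']
  rw [show ((k : ℕ) : ℝ) ^ 2 - E - ((k : ℕ) : ℝ) ^ 2 = -E by ring]
  field_simp
  ring

/-- Partial fractions: with q = |p|² + k², 1 / (q (q - Eₖ)) = Eₖ⁻¹ (1 / (q - Eₖ) - 1 / q). The
logarithm equals 2βₖ, so the second term of fₖ is exactly Eₖ⁻¹ / q and cancels the last fraction. -/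
lemma eigenvector_eq :
    eigenvector α k =
      ((energy α k)⁻¹ : ℂ) • mode k (resolventSymbol ((k : ℕ) ^ 2 - energy α k)) := by
  have hE := energy_ne_zero hα hs
  have hβ := β_ne_zero hα hs
  have h1 : toL2Plane (fun p =>
      (((‖p‖ ^ 2 + (k : ℕ) ^ 2) * (‖p‖ ^ 2 + (k : ℕ) ^ 2 - energy α k) : ℝ)⁻¹ : ℝ)) =
      ((energy α k)⁻¹ : ℂ) • (resolventSymbol ((k : ℕ) ^ 2 - energy α k) -
        resolventSymbol ((k : ℕ) ^ 2)) := by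
    have h2 : (fun p : Plane =>
        ((((‖p‖ ^ 2 + (k : ℕ) ^ 2) * (‖p‖ ^ 2 + (k : ℕ) ^ 2 - energy α k) : ℝ)⁻¹ : ℝ) : ℂ)) =
        fun p : Plane =>
        ((((‖p‖ ^ 2 + (k : ℕ) ^ 2) * (‖p‖ ^ 2 + ((k : ℕ) ^ 2 - energy α k)) : ℝ)⁻¹ : ℝ) : ℂ) := by
      simp_rw [add_sub_assoc]
    rw [h2]
    refine Lp.ext ?_
    filter_upwards [coeFn_toL2Plane (memLp_symbol (sq_pos k) (energy_lt α k)).2,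
      Lp.coeFn_smul ((energy α k)⁻¹ : ℂ) (resolventSymbol ((k : ℕ) ^ 2 - energy α k) -
        resolventSymbol ((k : ℕ) ^ 2)),
      Lp.coeFn_sub (resolventSymbol ((k : ℕ) ^ 2 - energy α k)) (resolventSymbol ((k : ℕ) ^ 2)),
      coeFn_resolventSymbol (sq_pos k), coeFn_resolventSymbol (energy_lt α k)]
      with p h3 h4 h5 h6 h7
    have hp1 : ‖p‖ ^ 2 + (k : ℕ) ^ 2 ≠ 0 := by have := sq_pos k; positivity
    have hp2 : ‖p‖ ^ 2 + ((k : ℕ) ^ 2 - energy α k) ≠ 0 := by have := energy_lt α k; positivity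
    rw [h3, h4, Pi.smul_apply, h5, Pi.sub_apply, h6, h7, smul_eq_mul]
    norm_cast
    simp only [PNat.pow_coe, Nat.cast_pow]
    field_simp
    ring
  rw [eigenvector, h1, log_div_sq_sub_energy]
  have h3 : (((2 * β α k * energy α k)⁻¹ * (2 * β α k) : ℝ) : ℂ) = ((energy α k)⁻¹ : ℂ) := by
    rw [← Complex.ofReal_inv]
    congr 1
    field_simp
  rw [h3, map_smul, map_sub, smul_sub]
  exact sub_add_cancel _ _

lemma mode_resolventSymbol_mem_graph :
    (mode k (resolventSymbol ((k : ℕ) ^ 2 - energy α k)),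
      (energy α k : ℂ) • mode k (resolventSymbol ((k : ℕ) ^ 2 - energy α k))) ∈
        (perturbedLaplacian α).graph := by
  have hβ := β_ne_zero hα hs
  rw [mem_graph_perturbedLaplacian, ← map_smul]
  refine mem_graph_perturbedInverse_mode ?_
  rw [coupling_smul, coupling_resolventSymbol hα hs (energy_ne_zero hα hs) (energy_lt α k),
    log_div_sq_sub_energy, inv_mul_cancel₀ (mul_ne_zero two_ne_zero hβ)]
  filter_upwards [coeFn_resolventSymbol (energy_lt α k),
    Lp.coeFn_smul (energy α k : ℂ) (resolventSymbol ((k : ℕ) ^ 2 - energy α k))] with p h1 h2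
  have hp : ‖p‖ ^ 2 + ((k : ℕ) ^ 2 - energy α k) ≠ 0 := by have := energy_lt α k; positivity
  rw [h2, Pi.smul_apply, h1, smul_eq_mul]
  norm_cast
  simp only [PNat.pow_coe, Nat.cast_pow]
  field_simp
  ring

lemma eigenvector_mem_graph :
    (eigenvector α k, (energy α k : ℂ) • eigenvector α k) ∈ (perturbedLaplacian α).graph := by
  rw [eigenvector_eq hα hs, smul_comm]
  exact (perturbedLaplacian α).graph.smul_mem _ (mode_resolventSymbol_mem_graph hα hs)

lemma eigenvector_ne_zero : eigenvector α k ≠ 0 := by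
  rw [eigenvector_eq hα hs]
  refine smul_ne_zero (inv_ne_zero (Complex.ofReal_ne_zero.2 (energy_ne_zero hα hs))) ?_
  rw [Ne, ← map_zero (mode k), (mode_injective k).eq_iff]
  intro h
  -- A zero symbol would have coupling 0, whereas Eₖ times this coupling is 1.
  have h1 := coupling_resolventSymbol hα hs (energy_ne_zero hα hs) (energy_lt α k)
  rw [h, log_div_sq_sub_energy, inv_mul_cancel₀ (mul_ne_zero two_ne_zero (β_ne_zero hα hs)),
    coupling, inner_zero_right] at h1
  simp at h1

/-- The part of an eigenvector in one mode. -/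
lemma eigenvector_component {E : ℝ} {x : L2Plane} (hx : x ≠ 0)
    (h : ∀ᵐ p : Plane, ((E : ℂ) • x) p =
      ((‖p‖ ^ 2 + (k : ℕ) ^ 2 : ℝ) : ℂ) * x p - coupling α k ((E : ℂ) • x)) :
    energy α k = E ∧ ∃ c : ℂ, mode k x = c • eigenvector α k := by
  set κ := coupling α k ((E : ℂ) • x) with hκ
  have h1 : ∀ᵐ p : Plane, ((‖p‖ ^ 2 + ((k : ℕ) ^ 2 - E) : ℝ) : ℂ) * x p = κ := by
    filter_upwards [h, Lp.coeFn_smul (E : ℂ) x] with p h2 h3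
    rw [h3, Pi.smul_apply, smul_eq_mul] at h2
    push_cast at h2 ⊢
    linear_combination -h2
  obtain ⟨-, h2⟩ | ⟨hEk, h2⟩ := eq_smul_resolventSymbol h1
  · exact absurd h2 hx
  have hκ0 : κ ≠ 0 := fun h0 => hx (by rw [h2, h0, zero_smul])
  have hE : E ≠ 0 := by
    rintro rfl
    exact hκ0 (by rw [hκ, coupling_smul, Complex.ofReal_zero, zero_mul])
  have hβ := β_ne_zero hα hs
  -- Self-consistency: inserting x = κ / (|p|² + k² - E) into the definition of κ and cancelling κ ≠
  -- 0.
  have h3 : (E : ℂ) * coupling α k (resolventSymbol ((k : ℕ) ^ 2 - E)) = 1 := by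
    have h4 := hκ
    rw [h2, coupling_smul, coupling_smul] at h4
    refine mul_left_cancel₀ hκ0 ?_
    rw [mul_one]
    conv_rhs => rw [h4]
    ring
  rw [coupling_resolventSymbol hα hs hE hEk] at h3
  have h5 : Real.log ((k : ℕ) ^ 2 / ((k : ℕ) ^ 2 - E)) = 2 * β α k := by
    have h6 : (2 * β α k)⁻¹ * Real.log ((k : ℕ) ^ 2 / ((k : ℕ) ^ 2 - E)) = 1 := by
      exact_mod_cast h3
    field_simp at h6
    linarith
  have h6 : energy α k = E := by
    have h7 : (k : ℕ) ^ 2 / ((k : ℕ) ^ 2 - E) = Real.exp (2 * β α k) := by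
      rw [← h5, Real.exp_log (div_pos (sq_pos k) hEk)]
    have h8 : (k : ℕ) ^ 2 - E = (k : ℕ) ^ 2 * Real.exp (-2 * β α k) := by
      rw [neg_mul, Real.exp_neg, ← h7]
      have := (sq_pos k).ne'
      field_simp
    rw [← sq_sub_energy] at h8
    linarith
  refine ⟨h6, κ * E, ?_⟩
  have hE' : (E : ℂ) ≠ 0 := Complex.ofReal_ne_zero.2 hE
  rw [eigenvector_eq hα hs, h6, smul_smul, mul_assoc, mul_inv_cancel₀ hE', mul_one, ← map_smul,
    ← h2]

/-- With q = |p|² + k², the vector w = (A - Eₖ)⁻¹ eₖ has symbol 1 / (q (q - Eₖ)), so Aw has symbol 1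
/ (q - Eₖ), which is that of Eₖ fₖ = Ã fₖ. -/
lemma exists_dirichletLaplacian_resolvent :
    ∃ w : dirichletLaplacian.domain, (w : L2Ω) ∈ LinearMap.range (mode k) ∧
      dirichletLaplacian w - (energy α k : ℂ) • (w : L2Ω) = e k ∧
      (energy α k : ℂ) • eigenvector α k = dirichletLaplacian w := by
  have hE : (energy α k : ℂ) ≠ 0 := Complex.ofReal_ne_zero.2 (energy_ne_zero hα hs)
  set x : L2Plane := ((energy α k)⁻¹ : ℂ) • (resolventSymbol ((k : ℕ) ^ 2 - energy α k) -
        resolventSymbol ((k : ℕ) ^ 2)) with hx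
  have hw : (mode k x, mode k (resolventSymbol ((k : ℕ) ^ 2 - energy α k))) ∈
      dirichletLaplacian.graph := by
    rw [dirichletLaplacian_graph]
    refine ⟨Pi.single k x, Pi.single k _, fun j => ?_, hasSum_mode_single _ _,
      hasSum_mode_single _ _⟩
    rcases eq_or_ne j k with rfl | hj
    · rw [Pi.single_eq_same, Pi.single_eq_same]
      filter_upwards [
        Lp.coeFn_smul ((energy α j)⁻¹ : ℂ) (resolventSymbol ((j : ℕ) ^ 2 - energy α j) -
          resolventSymbol ((j : ℕ) ^ 2)),
        Lp.coeFn_sub (resolventSymbol ((j : ℕ) ^ 2 - energy α j)) (resolventSymbol ((j : ℕ) ^ 2)),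
        coeFn_resolventSymbol (sq_pos j), coeFn_resolventSymbol (energy_lt α j)]
        with p h4 h5 h6 h7
      have hp1 : ‖p‖ ^ 2 + (j : ℕ) ^ 2 ≠ 0 := by have := sq_pos j; positivity
      have hp2 : ‖p‖ ^ 2 + ((j : ℕ) ^ 2 - energy α j) ≠ 0 := by have := energy_lt α j; positivity
      have hE' := energy_ne_zero hα hs
      rw [h4, Pi.smul_apply, h5, Pi.sub_apply, h6, h7, smul_eq_mul]
      norm_cast
      simp only [PNat.pow_coe, Nat.cast_pow]
      field_simp
      ring
    · rw [Pi.single_eq_of_ne hj, Pi.single_eq_of_ne hj]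
      filter_upwards [Lp.coeFn_zero ℂ 2 (volume : Measure Plane)] with p hp
      rw [hp, Pi.zero_apply, mul_zero]
  obtain ⟨w, hw1, hw2⟩ := (LinearPMap.mem_graph_iff _).1 hw
  refine ⟨w, ⟨x, hw1.symm⟩, ?_, ?_⟩
  · rw [hw1, hw2, hx, map_smul, smul_inv_smul₀ hE, map_sub, sub_sub_cancel, e_eq]
  · rw [hw2, eigenvector_eq hα hs, smul_inv_smul₀ hE]

end Eigenvalues

/-- The term -ln (k/2) in sₖ gives exp (-2βₖ) a factor 4 / k², so k² - Eₖ = 4 exp (2C + 2π² / (αk²))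
stays bounded. -/
lemma tendsto_energy {α : ℝ} (hα : α ≠ 0) : Tendsto (energy α) atTop atTop := by
  have hk : Tendsto (fun k : ℕ+ => ((k : ℕ) : ℝ)) atTop atTop :=
    tendsto_natCast_atTop_atTop.comp tendsto_PNat_val_atTop_atTop
  have hk2 : Tendsto (fun k : ℕ+ => ((k : ℕ) : ℝ) ^ 2) atTop atTop :=
    (tendsto_pow_atTop two_ne_zero).comp hk
  have h0 : Tendsto (fun k : ℕ+ => Real.pi ^ 2 * (α * ((k : ℕ) : ℝ) ^ 2)⁻¹) atTop (𝓝 0) := by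
    have h := (hk2.inv_tendsto_atTop.const_mul (Real.pi ^ 2 * α⁻¹))
    rw [mul_zero] at h
    refine h.congr fun k => ?_
    simp only [Pi.inv_apply, mul_inv]
    ring
  have hexp : ∀ k : ℕ+, energy α k = (k : ℕ) ^ 2 - 4 *
      (Real.exp (2 * Real.eulerMascheroniConstant) *
        Real.exp (2 * (Real.pi ^ 2 * (α * ((k : ℕ) : ℝ) ^ 2)⁻¹))) := by
    intro k
    have hk0 : ((k : ℕ) : ℝ) ≠ 0 := by exact_mod_cast k.pos.ne'
    have hkp : (0 : ℝ) < ((k : ℕ) : ℝ) / 2 := by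
      have : (0 : ℝ) < ((k : ℕ) : ℝ) := by exact_mod_cast k.pos
      positivity
    have hβ : -2 * β α k = (2 * Real.eulerMascheroniConstant +
        2 * (Real.pi ^ 2 * (α * ((k : ℕ) : ℝ) ^ 2)⁻¹)) - 2 * Real.log ((k : ℕ) / 2) := by
      have hpi := Real.pi_ne_zero
      rw [β, s]
      field_simp
      ring
    have h2 : Real.exp (2 * Real.log ((k : ℕ) / 2)) = (((k : ℕ) : ℝ) / 2) ^ 2 := by
      rw [two_mul, Real.exp_add, Real.exp_log hkp]
      ring
    rw [energy, hβ, Real.exp_sub, Real.exp_add, h2]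
    field_simp
    ring
  rw [funext hexp]
  simp_rw [sub_eq_add_neg]
  refine hk2.atTop_add (C := -(4 * (Real.exp (2 * Real.eulerMascheroniConstant) *
    Real.exp (2 * 0)))) ?_
  exact (((Real.continuous_exp.tendsto _).comp (h0.const_mul 2)).const_mul _).const_mul 4 |>.neg

/-! ### Eigenvectors with components in several modes -/

section

variable {α : ℝ} (hα : α ≠ 0) (hs : ∀ k : ℕ+, 1 + α * (k : ℕ) ^ 2 * s k ≠ 0)

include hα hs

lemma exists_components_of_eigenvector {E : ℝ} {f : (perturbedLaplacian α).domain}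
    (hf : perturbedLaplacian α f = (E : ℂ) • (f : L2Ω)) :
    ∃ x : ℕ+ → L2Plane, HasSum (fun k => mode k (x k)) (f : L2Ω) ∧
      ∀ k, x k ≠ 0 → energy α k = E ∧ ∃ c : ℂ, mode k (x k) = c • eigenvector α k := by
  have h := (perturbedLaplacian α).mem_graph f
  rw [hf, mem_graph_perturbedLaplacian] at h
  obtain ⟨x, b, hx, hb, hxb⟩ := exists_of_mem_graph_perturbedInverse h
  refine ⟨x, hx, fun k hk => eigenvector_component hα (hs k) hk ?_⟩
  have h1 : HasSum (fun k => mode k ((E : ℂ) • x k)) ((E : ℂ) • (f : L2Ω)) := by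
    simpa only [map_smul] using hx.const_smul (E : ℂ)
  have h2 := eq_of_hasSum_mode hb h1 k
  have h3 := hxb k
  rwa [h2] at h3

lemma pointSpectrum_perturbedLaplacian :
    pointSpectrum (perturbedLaplacian α) = Set.range (energy α) := by
  ext E
  constructor
  · rintro ⟨f, hf0, hf⟩
    obtain ⟨x, hx, h⟩ := exists_components_of_eigenvector hα hs hf
    by_contra hE
    have hx0 : ∀ k, x k = 0 := fun k => by
      by_contra hk
      exact hE ⟨k, (h k hk).1⟩
    refine hf0 (hx.unique ?_)
    simp [hx0]
  · rintro ⟨k, rfl⟩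
    obtain ⟨f, hf1, hf2⟩ := (LinearPMap.mem_graph_iff _).1 (eigenvector_mem_graph hα (hs k))
    exact ⟨f, hf1 ▸ eigenvector_ne_zero hα (hs k), hf2.trans (by rw [hf1])⟩

lemma mem_span_eigenvector {E : ℝ} {f : (perturbedLaplacian α).domain}
    (hf : perturbedLaplacian α f = (E : ℂ) • (f : L2Ω)) :
    (f : L2Ω) ∈ Submodule.span ℂ {g | ∃ k : ℕ+, energy α k = E ∧ g = eigenvector α k} := by
  obtain ⟨x, hx, h⟩ := exists_components_of_eigenvector hα hs hf
  -- The span is algebraic, so the series must be finite: Eₖ > E for k ≥ K.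
  obtain ⟨K, hK⟩ := eventually_atTop.1 ((tendsto_energy hα).eventually_gt_atTop E)
  have h0 : ∀ k ∉ Finset.Iio K, mode k (x k) = 0 := fun k hk => by
    by_contra hk0
    have hxk : x k ≠ 0 := fun h0 => hk0 (by rw [h0, map_zero])
    exact (hK k (not_lt.1 fun h1 => hk (Finset.mem_Iio.2 h1))).ne' (h k hxk).1
  rw [hx.unique (hasSum_sum_of_ne_finset_zero h0)]
  refine Submodule.sum_mem _ fun k _ => ?_
  by_cases hk : x k = 0
  · rw [hk, map_zero]
    exact Submodule.zero_mem _
  · obtain ⟨hE, c, hc⟩ := h k hk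
    rw [hc]
    exact Submodule.smul_mem _ _ (Submodule.subset_span ⟨k, hE, rfl⟩)

end

/-! ### Absolutely continuous spectrum -/

/-- An odd square integrable function of modulus `1 / (|p|² + 1)`. -/
def oddSymbol (p : Plane) : ℂ :=
  ((p 0 : ℂ) + p 1 * Complex.I) * (((‖p‖ * (‖p‖ ^ 2 + 1) : ℝ)⁻¹ : ℝ) : ℂ)

lemma oddSymbol_neg (p : Plane) : oddSymbol (-p) = -oddSymbol p := by
  simp only [oddSymbol, PiLp.neg_apply, norm_neg, Complex.ofReal_neg]
  ring

lemma measurable_oddSymbol : Measurable oddSymbol := by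
  unfold oddSymbol
  fun_prop

lemma norm_oddSymbol {p : Plane} (hp : p ≠ 0) : ‖oddSymbol p‖ = (‖p‖ ^ 2 + 1)⁻¹ := by
  have h : ‖(p 0 : ℂ) + p 1 * Complex.I‖ = ‖p‖ := by
    rw [Complex.norm_add_mul_I, EuclideanSpace.norm_eq, Fin.sum_univ_two, Real.norm_eq_abs,
      Real.norm_eq_abs, sq_abs, sq_abs]
  have hp' : ‖p‖ ≠ 0 := norm_ne_zero_iff.2 hp
  rw [oddSymbol, norm_mul, h, Complex.norm_real, Real.norm_of_nonneg (by positivity)]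
  field_simp

lemma ae_ne_zero : ∀ᵐ p : Plane, p ≠ 0 := by
  filter_upwards [ae_norm_sq_add_ne_zero 0] with p hp h
  simp [h] at hp

lemma memLp_oddSymbol : MemLp oddSymbol 2 volume := by
  refine (memLp_symbol one_pos one_pos).1.of_le measurable_oddSymbol.aestronglyMeasurable ?_
  filter_upwards [ae_ne_zero] with p hp
  rw [norm_oddSymbol hp, Complex.norm_real, Real.norm_of_nonneg (by positivity)]

lemma ofReal_sub_ne_zero {z : ℂ} (hz : z.im ≠ 0) (t : ℝ) : (t : ℂ) - z ≠ 0 := by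
  intro h
  have := congrArg Complex.im h
  simp at this
  exact hz this

lemma memLp_oddSymbol_mul_resolvent {z : ℂ} (hz : z.im ≠ 0) :
    MemLp (fun p => oddSymbol p * (((‖p‖ ^ 2 + 1 : ℝ) : ℂ) - z)⁻¹) 2 volume := by
  have hm : Measurable fun p : Plane => oddSymbol p * (((‖p‖ ^ 2 + 1 : ℝ) : ℂ) - z)⁻¹ := by
    have := measurable_oddSymbol
    fun_prop
  refine (memLp_oddSymbol.const_mul ((|z.im|⁻¹ : ℝ) : ℂ)).of_le hm.aestronglyMeasurable
    (Eventually.of_forall fun p => ?_)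
  have h1 : |z.im| ≤ ‖((‖p‖ ^ 2 + 1 : ℝ) : ℂ) - z‖ := by
    have h := Complex.abs_im_le_norm (((‖p‖ ^ 2 + 1 : ℝ) : ℂ) - z)
    rwa [Complex.sub_im, Complex.ofReal_im, zero_sub, abs_neg] at h
  rw [norm_mul, norm_mul, Complex.norm_real, Real.norm_of_nonneg (by positivity), norm_inv,
    mul_comm]
  exact mul_le_mul_of_nonneg_right (inv_anti₀ (abs_pos.2 hz) h1) (norm_nonneg _)

/-- The coupling pairs with an even function, so the reflection p ↦ -p kills it on odd symbols. -/
lemma coupling_eq_zero_of_odd (α : ℝ) (k : ℕ+) {b : L2Plane} {g : Plane → ℂ}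
    (hb : b =ᵐ[volume] g) (hg : ∀ p, g (-p) = -g p) : coupling α k b = 0 := by
  have h1 : inner ℂ (resolventSymbol ((k : ℕ) ^ 2)) b =
      ∫ p : Plane, g p * (((‖p‖ ^ 2 + (k : ℕ) ^ 2 : ℝ)⁻¹ : ℝ) : ℂ) := by
    rw [L2.inner_def]
    refine integral_congr_ae ?_
    filter_upwards [hb, coeFn_resolventSymbol (sq_pos k)] with p h2 h3
    rw [h2, h3, RCLike.inner_apply, Complex.conj_ofReal]
  have h2 : ∫ p : Plane, g p * (((‖p‖ ^ 2 + (k : ℕ) ^ 2 : ℝ)⁻¹ : ℝ) : ℂ) = 0 := by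
    have h3 := integral_neg_eq_self
      (fun p : Plane => g p * (((‖p‖ ^ 2 + (k : ℕ) ^ 2 : ℝ)⁻¹ : ℝ) : ℂ)) volume
    simp only [hg, norm_neg, neg_mul, integral_neg] at h3
    exact self_eq_neg.1 h3.symm
  rw [coupling, h1, h2, mul_zero, mul_zero]

/-- The perturbation does not see odd symbols, so the spectral measure is the image under |p|² + 1
of the density |η|² / (2π³), the constant being that of `inner_mode`. -/
lemma mode_oddSymbol_mem_acSubspace (α : ℝ) :
    mode 1 (toL2Plane oddSymbol) ∈ acSubspace (perturbedLaplacian α) := by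
  have hm : Measurable fun p : Plane => ‖p‖ ^ 2 + 1 := (measurable_norm.pow_const 2).add_const 1
  have hdm : Measurable fun p : Plane => (2 * Real.pi ^ 3)⁻¹ * ‖oddSymbol p‖ ^ 2 :=
    (measurable_oddSymbol.norm.pow_const 2).const_mul _
  have hdi : Integrable (fun p : Plane => (2 * Real.pi ^ 3)⁻¹ * ‖oddSymbol p‖ ^ 2) volume :=
    ((memLp_two_iff_integrable_sq_norm measurable_oddSymbol.aestronglyMeasurable).1
      memLp_oddSymbol).const_mul _
  have hη := coeFn_toL2Plane memLp_oddSymbol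
  set ν : Measure Plane :=
    volume.withDensity fun p => ENNReal.ofReal ((2 * Real.pi ^ 3)⁻¹ * ‖oddSymbol p‖ ^ 2) with hν
  have hfin : IsFiniteMeasure ν := isFiniteMeasure_withDensity_ofReal hdi.2
  refine ⟨ν.map fun p => ‖p‖ ^ 2 + 1, ⟨inferInstance, fun z hz => ?_⟩,
    ((withDensity_absolutelyContinuous _ _).map hm).trans
      (map_norm_sq_add_absolutelyContinuous 1)⟩
  -- The free resolvent applied to η; as η + zx is odd, it is also the resolvent of Ã.
  set x : L2Plane := toL2Plane fun p => oddSymbol p * (((‖p‖ ^ 2 + 1 : ℝ) : ℂ) - z)⁻¹ with hx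
  have hxc := coeFn_toL2Plane (memLp_oddSymbol_mul_resolvent hz)
  have hb : (toL2Plane oddSymbol + z • x : L2Plane) =ᵐ[volume] fun p =>
      oddSymbol p + z * (oddSymbol p * (((‖p‖ ^ 2 + 1 : ℝ) : ℂ) - z)⁻¹) := by
    filter_upwards [hxc, hη, Lp.coeFn_add (toL2Plane oddSymbol) (z • x), Lp.coeFn_smul z x]
      with p h1 h2 h3 h4
    rw [h3, Pi.add_apply, h4, Pi.smul_apply, h2, h1, smul_eq_mul]
  have hc : coupling α 1 (toL2Plane oddSymbol + z • x) = 0 :=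
    coupling_eq_zero_of_odd α 1 hb fun p => by
      rw [oddSymbol_neg, norm_neg]
      ring
  have hg : (mode 1 x, mode 1 (toL2Plane oddSymbol + z • x)) ∈ (perturbedLaplacian α).graph := by
    rw [mem_graph_perturbedLaplacian]
    refine mem_graph_perturbedInverse_mode ?_
    rw [hc]
    filter_upwards [hb, hxc] with p h1 h2
    have h3 := ofReal_sub_ne_zero hz (‖p‖ ^ 2 + 1)
    rw [h1, h2]
    simp only [PNat.one_coe, Nat.cast_one, one_pow]
    field_simp
    ring
  obtain ⟨u, hu1, hu2⟩ := (LinearPMap.mem_graph_iff _).1 hg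
  refine ⟨u, ?_, ?_⟩
  · rw [hu1, hu2, map_add, map_smul, add_sub_cancel_right]
  · rw [hu1, inner_mode, if_pos rfl, L2.inner_def, ← integral_const_mul,
      integral_map hm.aemeasurable (by
        refine Measurable.aestronglyMeasurable ?_
        fun_prop), hν,
      integral_withDensity_eq_integral_toReal_smul hdm.ennreal_ofReal
        (Eventually.of_forall fun _ => ENNReal.ofReal_lt_top)]
    refine integral_congr_ae ?_
    filter_upwards [hη, hxc] with p h1 h2
    rw [h1, h2, ENNReal.toReal_ofReal (by positivity), RCLike.inner_apply, Complex.real_smul,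
      mul_right_comm, Complex.mul_conj, Complex.normSq_eq_norm_sq]
    push_cast
    ring

/-- In mode 1 a solution satisfies (|p|² + 1 - E) x = η + κ. Subtracting the reflected equation
removes the unknown κ and leaves 2η, whose modulus is 2 / (|p|² + 1). -/
lemma not_exists_resolvent_oddSymbol (α : ℝ) {E : ℝ} (hE : 1 ≤ E)
    (f : (perturbedLaplacian α).domain) :
    perturbedLaplacian α f - (E : ℂ) • (f : L2Ω) ≠ mode 1 (toL2Plane oddSymbol) := by
  intro hf
  have h := (perturbedLaplacian α).mem_graph f
  rw [sub_eq_iff_eq_add.1 hf, mem_graph_perturbedLaplacian] at h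
  obtain ⟨x, b, hx, hb, hxb⟩ := exists_of_mem_graph_perturbedInverse h
  set η : L2Plane := toL2Plane oddSymbol with hη
  have hb1 : b 1 = η + (E : ℂ) • x 1 := by
    have h1 : HasSum (fun k => mode k ((Pi.single 1 η : ℕ+ → L2Plane) k + (E : ℂ) • x k))
        (mode 1 η + (E : ℂ) • (f : L2Ω)) := by
      simpa only [map_add, map_smul] using (hasSum_mode_single 1 η).add (hx.const_smul (E : ℂ))
    simpa using eq_of_hasSum_mode hb h1 1
  set κ := coupling α 1 (b 1) with hκ
  have h1 : ∀ᵐ p : Plane, ((‖p‖ ^ 2 + (1 - E) : ℝ) : ℂ) * x 1 p = oddSymbol p + κ := by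
    have h2 := hxb 1
    rw [hb1] at h2
    filter_upwards [h2, Lp.coeFn_add η ((E : ℂ) • x 1), Lp.coeFn_smul (E : ℂ) (x 1),
      coeFn_toL2Plane memLp_oddSymbol] with p h3 h4 h5 h6
    rw [h4, Pi.add_apply, h5, Pi.smul_apply, h6, smul_eq_mul, ← hb1, ← hκ] at h3
    simp only [PNat.one_coe, Nat.cast_one, one_pow] at h3
    push_cast at h3 ⊢
    linear_combination -h3
  have hneg := (Measure.measurePreserving_neg (volume : Measure Plane))
  have h2 : ∀ᵐ p : Plane, ((‖p‖ ^ 2 + (1 - E) : ℝ) : ℂ) * x 1 (-p) = -oddSymbol p + κ := by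
    filter_upwards [hneg.quasiMeasurePreserving.ae h1] with p hp
    rwa [norm_neg, oddSymbol_neg] at hp
  have hmem : MemLp (fun p : Plane => x 1 p - x 1 (-p)) 2 volume :=
    (Lp.memLp (x 1)).sub ((Lp.memLp (x 1)).comp_measurePreserving hneg)
  refine not_memLp_inv_of_nonpos (sub_nonpos.2 hE) ?_
  have hm : Measurable (fun p : Plane => (((‖p‖ ^ 2 + (1 - E) : ℝ)⁻¹ : ℝ) : ℂ)) :=
    Complex.measurable_ofReal.comp ((measurable_norm.pow_const 2).add_const _).inv
  -- With q = |p|² + 1, the bound q ≤ E + |q - E| gives 1 / |q - E| ≤ (E/2) |x(p) - x(-p)| + 1 / q,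
  -- since |x(p) - x(-p)| = 2 / (q |q - E|).
  have hdom := ((hmem.norm.const_mul (E / 2)).add (memLp_symbol one_pos one_pos).1.norm)
  refine hdom.of_le hm.aestronglyMeasurable ?_
  filter_upwards [h1, h2, ae_ne_zero, ae_norm_sq_add_ne_zero (1 - E)] with p h3 h4 h5 h6
  have h7 : |‖p‖ ^ 2 + (1 - E)| * ‖x 1 p - x 1 (-p)‖ = 2 * (‖p‖ ^ 2 + 1)⁻¹ := by
    rw [← norm_oddSymbol h5, ← Real.norm_eq_abs, ← Complex.norm_real, ← norm_mul, mul_sub, h3, h4,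
      add_sub_add_right_eq_sub, sub_neg_eq_add, ← two_mul, norm_mul, Complex.norm_ofNat]
  have h8 : 0 < |‖p‖ ^ 2 + (1 - E)| := abs_pos.2 h6
  have h9 : ‖x 1 p - x 1 (-p)‖ = 2 * (‖p‖ ^ 2 + 1)⁻¹ * |‖p‖ ^ 2 + (1 - E)|⁻¹ := by
    rw [← h7]
    field_simp
  have h10 : ‖p‖ ^ 2 + 1 ≤ E + |‖p‖ ^ 2 + (1 - E)| := by
    linarith [le_abs_self (‖p‖ ^ 2 + (1 - E))]
  simp only [Pi.add_apply]
  rw [h9, Complex.norm_real, Complex.norm_real, Real.norm_eq_abs, abs_inv,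
    Real.norm_of_nonneg (show 0 ≤ (‖p‖ ^ 2 + 1)⁻¹ by positivity),
    Real.norm_of_nonneg (by positivity)]
  have h11 : E / 2 * (2 * (‖p‖ ^ 2 + 1)⁻¹ * |‖p‖ ^ 2 + (1 - E)|⁻¹) + (‖p‖ ^ 2 + 1)⁻¹ =
      (E + |‖p‖ ^ 2 + (1 - E)|) / ((‖p‖ ^ 2 + 1) * |‖p‖ ^ 2 + (1 - E)|) := by
    field_simp
  rw [h11, le_div_iff₀ (by positivity), inv_mul_eq_div, mul_div_assoc, div_self h8.ne', mul_one]
  exact h10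

lemma mem_acSpectrum_of_one_le (α : ℝ) {E : ℝ} (hE : 1 ≤ E) :
    E ∈ acSpectrum (perturbedLaplacian α) := by
  intro h
  obtain ⟨f, ⟨-, hf⟩, -⟩ := h _ (mode_oddSymbol_mem_acSubspace α)
  exact not_exists_resolvent_oddSymbol α hE f hf

end SingularLaplace

end

open SingularLaplace in
theorem mainTheorem11 (α : ℝ) (hα : α ≠ 0)
    (hs : ∀ k : ℕ+, 1 + α * (k : ℕ) ^ 2 * s k ≠ 0) :
    -- the eigenvalues are exactly the numbers `Eₖ`
    pointSpectrum (perturbedLaplacian α) = Set.range (energy α) ∧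
    -- `fₖ` is an eigenvector for `Eₖ`, and `fₖ = Ã⁻¹ A (A - Eₖ)⁻¹ eₖ`, the resolvent being
    -- that of the part of `A` in the range of `mode k`
    (∀ k : ℕ+, eigenvector α k ≠ 0 ∧
      ∃ f : (perturbedLaplacian α).domain, (f : L2Ω) = eigenvector α k ∧
        perturbedLaplacian α f = (energy α k : ℂ) • eigenvector α k ∧
        ∃ w : dirichletLaplacian.domain, (w : L2Ω) ∈ LinearMap.range (mode k) ∧
          dirichletLaplacian w - (energy α k : ℂ) • (w : L2Ω) = e k ∧
          perturbedLaplacian α f = dirichletLaplacian w) ∧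
    -- every eigenvector is a linear combination of the `fₖ`
    (∀ (E : ℝ) (f : (perturbedLaplacian α).domain),
      perturbedLaplacian α f = (E : ℂ) • (f : L2Ω) →
        (f : L2Ω) ∈ Submodule.span ℂ {g | ∃ k : ℕ+, energy α k = E ∧ g = eigenvector α k}) ∧
    -- `Eₖ → ∞`, and `Eₖ` lies in the absolutely continuous spectrum for all large `k`
    Tendsto (energy α) atTop atTop ∧
    ∀ᶠ k : ℕ+ in atTop, energy α k ∈ acSpectrum (perturbedLaplacian α) := by
  refine ⟨pointSpectrum_perturbedLaplacian hα hs, fun k => ⟨eigenvector_ne_zero hα (hs k), ?_⟩,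
    fun E f hf => mem_span_eigenvector hα hs hf, tendsto_energy hα, ?_⟩
  · obtain ⟨f, hf1, hf2⟩ := (LinearPMap.mem_graph_iff _).1 (eigenvector_mem_graph hα (hs k))
    obtain ⟨w, hw1, hw2, hw3⟩ := exists_dirichletLaplacian_resolvent hα (hs k)
    exact ⟨f, hf1, hf2, w, hw1, hw2, hf2.trans hw3⟩
  · filter_upwards [(tendsto_energy hα).eventually_ge_atTop 1] with k hk
    exact mem_acSpectrum_of_one_le α hk
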